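/- Let $\alpha,\beta>-1$ and let $M,N$ be nonzero real numbers. Let $d\mu(x)=(1-x)^{\alpha}(1+x)^{\beta}\,dx$ on $[-1,1]$ and, for real polynomials $p,q$, put $$\langle p,q\rangle_S=\int_{-1}^{1}p(x)q(x)\,d\mu(x)+M\,p(-1)q(-1)+N\,p'(-1)q'(-1)$$ (an inner product when $M,N>0$). Let $P_n^{(\alpha,\beta)}$ be the monic Jacobi polynomial of degree $n$, i.e. the monic polynomial of degree $n$ orthogonal in $L^2(\mu)$ to all polynomials of degree less than $n$. Put $$c_n=\frac{(n+\alpha+\beta+1)_n}{2^n(\alpha+1)_n},\qquad \tilde P_n^{(\alpha,\beta)}=c_n\,P_n^{(\alpha,\beta)},$$ where $(x)_n=x(x+1)\cdots(x+n-1)$. Then for all sufficiently large $n$ there is exactly one monic polynomial of degree $n$ that is orthogonal with respect to $\langle\cdot,\cdot\rangle_S$ to all polynomials of degree less than $n$; let $Q_n^{M,N}$ be $c_n$ times this polynomial (so $Q_n^{M,N}$ has the same leading coefficient as $\tilde P_n^{(\alpha,\beta)}$). For every integer $j\ge 0$, $(\tilde P_n^{(\alpha,\beta)})^{(j)}(-1)\neq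 0$ for all sufficiently large $n$, and $$\lim_{n\to\infty}\frac{(Q_n^{M,N})^{(j)}(-1)}{(\tilde P_n^{(\alpha,\beta)})^{(j)}(-1)}=\frac{j(j-1)}{(\beta+j+1)(\beta+j+2)}.$$ In particular the limit does not depend on $M$ and $N$. -/

import Mathlib

open Polynomial Filter Topology

/-- `q` is monic of degree `n` and orthogonal, with respect to the form `B`, to every polynomial
of degree less than `n`. -/
def IsMonicOrthogonal (B : ℝ[X] → ℝ[X] → ℝ) (n : ℕ) (q : ℝ[X]) : Prop :=
  q.Monic ∧ q.natDegree = n ∧ ∀ p : ℝ[X], p.degree < (n : WithBot ℕ) → B q p = 0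

open Classical in
/-- The monic orthogonal polynomial of degree `n` for the form `B`
(with the convention `0` if there is not exactly one). -/
noncomputable def monicOrthogonal (B : ℝ[X] → ℝ[X] → ℝ) (n : ℕ) : ℝ[X] :=
  if h : ∃! q : ℝ[X], IsMonicOrthogonal B n q then h.choose else 0

/-- `⟨p, q⟩_μ = ∫ p q dμ` for the Jacobi measure `dμ = (1 - x)^α (1 + x)^β dx` on `[-1, 1]`. -/
noncomputable def jacobiForm (α β : ℝ) (p q : ℝ[X]) : ℝ :=
  ∫ x in (-1 : ℝ)..1, p.eval x * q.eval x * ((1 - x) ^ α * (1 + x) ^ β)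

/-- `⟨p, q⟩_S = ∫ p q dμ + M p(a) q(a) + N p'(a) q'(a)` with `μ` the Jacobi measure. -/
noncomputable def sobolevForm (α β a M N : ℝ) (p q : ℝ[X]) : ℝ :=
  jacobiForm α β p q + M * p.eval a * q.eval a
    + N * (derivative p).eval a * (derivative q).eval a

/-- The scaling factor `(n + α + β + 1)_n / (2^n (α + 1)_n)`, where `(x)_n = x (x+1) ⋯ (x+n-1)`. -/
noncomputable def jacobiScale (α β : ℝ) (n : ℕ) : ℝ :=
  (ascPochhammer ℝ n).eval ((n : ℝ) + α + β + 1) / (2 ^ n * (ascPochhammer ℝ n).eval (α + 1))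

/-- The scaled Jacobi polynomial: the scaling factor times the monic Jacobi polynomial. -/
noncomputable def scaledJacobi (α β : ℝ) (n : ℕ) : ℝ[X] :=
  C (jacobiScale α β n) * monicOrthogonal (jacobiForm α β) n

/-- The Sobolev-type orthogonal polynomial of degree `n` for the point `a = -1`, normalized to
have the same leading coefficient as the scaled Jacobi polynomial. -/
noncomputable def scaledSobolevJacobi (α β M N : ℝ) (n : ℕ) : ℝ[X] :=
  C (jacobiScale α β n) * monicOrthogonal (sobolevForm α β (-1) M N) n

/-! Let P_n be the monic Jacobi polynomials, h_n their squared norms, and K_ij(n) = ∑_{m<n}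
P_m^{(i)}(-1) P_m^{(j)}(-1) / h_m. If k_i represents p ↦ p^{(i)}(-1) on polynomials of degree < n,
the monic Sobolev polynomial is Q = P_n - M Q(-1) k_0 - N Q'(-1) k_1. Evaluating Q and Q' at -1
gives a 2×2 linear system for (Q(-1), Q'(-1)) with coefficients built from the K_ij
(`perturbed_values`, `existsUnique_perturbed`). Only a nonzero determinant is needed, so M and N may
have any sign.

It remains to find the asymptotics of K_ij, which uses ratios of consecutive terms instead of Gamma
functions. The Jacobi equation, differentiated j times and taken at -1, gives P_n^{(j)}(-1) /
P_n(-1) as a product; the three-term recurrence at -1 gives h_{n+1} / h_n. If t_n is the absolute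
value of the n-th term of K_ij and f_n = n t_n, then f_{n+1} / f_n = 1 + s/n + o(1/n) with s =
2(β+1+i+j), and a Stolz–Cesàro argument (`tendsto_sum_div_of_oneAddDivAsymptotic`) yields |K_ij(n)|
~ f_n / s.

In Q^{(j)}(-1) / P_n^{(j)}(-1) all growing factors cancel, and M, N survive only in terms tending to
0. The limit has the form 1 - A/(β+1+j) - B/(β+2+j). By Cramer's rule it vanishes at j = 0 and j =
1, hence its numerator is j(j-1). -/

theorem Polynomial.Monic.degree_sub_lt_natCast {p q : ℝ[X]} {n : ℕ} (hp : p.Monic) (hq : q.Monic)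
    (hpn : p.natDegree = n) (hqn : q.natDegree = n) : (p - q).degree < n := by
  have h1 : p.degree = n := by rw [degree_eq_natDegree hp.ne_zero, hpn]
  have h2 : q.degree = n := by rw [degree_eq_natDegree hq.ne_zero, hqn]
  rw [← h1]
  exact degree_sub_lt_left (h1.trans h2.symm) hp.ne_zero (by rw [hp, hq])

theorem monicOrthogonal_spec {B : ℝ[X] → ℝ[X] → ℝ} {n : ℕ}
    (h : ∃! q : ℝ[X], IsMonicOrthogonal B n q) : IsMonicOrthogonal B n (monicOrthogonal B n) := by
  rw [monicOrthogonal, dif_pos h]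
  exact h.choose_spec.1

/-! ### Orthogonal polynomials of a positive definite form -/

section PositiveDefinite

variable {B : LinearMap.BilinForm ℝ ℝ[X]}

theorem IsMonicOrthogonal.degree_lt {n m : ℕ} {q : ℝ[X]} {B : ℝ[X] → ℝ[X] → ℝ}
    (h : IsMonicOrthogonal B n q) (hnm : n < m) : q.degree < m := by
  refine lt_of_le_of_lt degree_le_natDegree ?_
  rw [h.2.1]; exact_mod_cast hnm

theorem IsMonicOrthogonal.norm_pos (hpos : ∀ p, p ≠ 0 → 0 < B p p) {n : ℕ} {q : ℝ[X]}
    (h : IsMonicOrthogonal (fun p q => B p q) n q) : 0 < B q q :=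
  hpos _ h.1.ne_zero

theorem orthogonal_of_ne (hsymm : ∀ p q, B p q = B q p) {P : ℕ → ℝ[X]} {n m : ℕ}
    (hn : IsMonicOrthogonal (fun p q => B p q) n (P n))
    (hm : IsMonicOrthogonal (fun p q => B p q) m (P m)) (hnm : n ≠ m) : B (P n) (P m) = 0 := by
  rcases lt_or_gt_of_ne hnm with h | h
  · rw [hsymm]; exact hm.2.2 _ (hn.degree_lt h)
  · exact hn.2.2 _ (hm.degree_lt h)

theorem eq_sum_orthogonal (hsymm : ∀ p q, B p q = B q p) (hpos : ∀ p, p ≠ 0 → 0 < B p p)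
    {P : ℕ → ℝ[X]} {n : ℕ} (hP : ∀ m < n, IsMonicOrthogonal (fun p q => B p q) m (P m))
    {p : ℝ[X]} (hp : p.degree < n) :
    p = ∑ m ∈ Finset.range n, (B p (P m) / B (P m) (P m)) • P m := by
  induction n generalizing p with
  | zero => simpa [degree_eq_bot] using hp
  | succ n ih =>
    have hn := hP n n.lt_succ_self
    have hPn : (P n).coeff n = 1 := by
      have := hn.1
      rwa [Monic, leadingCoeff, hn.2.1] at this
    have hdeg : (p - p.coeff n • P n).degree < n := by
      rw [degree_lt_iff_coeff_zero]
      intro m hm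
      rcases hm.eq_or_lt with rfl | hm
      · simp [hPn]
      · rw [coeff_sub, coeff_smul, coeff_eq_zero_of_degree_lt (n := m),
          coeff_eq_zero_of_degree_lt (n := m) (hn.degree_lt hm), smul_zero, sub_zero]
        refine hp.trans_le ?_
        exact_mod_cast hm
    have h1 := ih (fun m hm => hP m (hm.trans n.lt_succ_self)) hdeg
    have h2 : B p (P n) = p.coeff n * B (P n) (P n) := by
      have h3 : B (P n) (p - p.coeff n • P n) = 0 := hn.2.2 _ hdeg
      rw [map_sub, map_smul, smul_eq_mul, sub_eq_zero] at h3
      rw [hsymm, h3]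
    rw [Finset.sum_range_succ, h2, mul_div_cancel_right₀ _ (hn.norm_pos hpos).ne',
      ← sub_eq_iff_eq_add, h1]
    refine Finset.sum_congr rfl fun m hm => ?_
    rw [Finset.mem_range] at hm
    have h4 := orthogonal_of_ne hsymm hn (hP m (hm.trans n.lt_succ_self)) hm.ne'
    simp [h4]

/-- Gram–Schmidt applied to `X ^ n`. -/
theorem exists_isMonicOrthogonal (hsymm : ∀ p q, B p q = B q p)
    (hpos : ∀ p, p ≠ 0 → 0 < B p p) (n : ℕ) :
    ∃ q, IsMonicOrthogonal (fun p q => B p q) n q := by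
  induction n using Nat.strong_induction_on with
  | _ n ih =>
    choose! P hP using ih
    have hdeg : (∑ m ∈ Finset.range n, (B (X ^ n) (P m) / B (P m) (P m)) • P m).degree
        < (n : WithBot ℕ) := by
      rw [← mem_degreeLT]
      refine Submodule.sum_mem _ fun m hm => Submodule.smul_mem _ _ ?_
      rw [mem_degreeLT]
      exact (hP m (Finset.mem_range.1 hm)).degree_lt (Finset.mem_range.1 hm)
    have hdeg' := hdeg
    rw [← degree_X_pow (R := ℝ) n] at hdeg'
    refine ⟨X ^ n - ∑ m ∈ Finset.range n, (B (X ^ n) (P m) / B (P m) (P m)) • P m,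
      (monic_X_pow n).sub_of_left hdeg', ?_, fun p hp => ?_⟩
    · rw [natDegree_eq_of_degree_eq (degree_sub_eq_left_of_degree_lt hdeg'), natDegree_X_pow]
    · show B _ p = 0
      rw [eq_sum_orthogonal hsymm hpos hP hp, map_sum]
      refine Finset.sum_eq_zero fun m hm => ?_
      rw [Finset.mem_range] at hm
      rw [map_smul, map_sub, LinearMap.sub_apply, map_sum, LinearMap.sum_apply,
        Finset.sum_eq_single_of_mem m (Finset.mem_range.2 hm)]
      · rw [map_smul, LinearMap.smul_apply, smul_eq_mul (_ / _) (B (P m) (P m)),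
          div_mul_cancel₀ _ ((hP m hm).norm_pos hpos).ne', sub_self, smul_zero]
      · intro k hk hkm
        rw [map_smul, LinearMap.smul_apply,
          orthogonal_of_ne hsymm (hP k (Finset.mem_range.1 hk)) (hP m hm) hkm, smul_zero]

theorem existsUnique_isMonicOrthogonal (hsymm : ∀ p q, B p q = B q p)
    (hpos : ∀ p, p ≠ 0 → 0 < B p p) (n : ℕ) :
    ∃! q, IsMonicOrthogonal (fun p q => B p q) n q := by
  obtain ⟨q, hq⟩ := exists_isMonicOrthogonal hsymm hpos n
  refine ⟨q, hq, fun r hr => ?_⟩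
  by_contra hne
  have hd := hr.1.degree_sub_lt_natCast hq.1 hr.2.1 hq.2.1
  have h1 : B r (r - q) = 0 := hr.2.2 _ hd
  have h2 : B q (r - q) = 0 := hq.2.2 _ hd
  have h3 := hpos (r - q) (sub_ne_zero.2 hne)
  rw [LinearMap.map_sub₂, h1, h2, sub_self] at h3
  exact h3.false

/-- The polynomial representing the linear functional `φ` on polynomials of degree `< n`, given
the orthogonal family `P`. -/
noncomputable def reproducing (B : LinearMap.BilinForm ℝ ℝ[X]) (P : ℕ → ℝ[X])
    (φ : ℝ[X] →ₗ[ℝ] ℝ) (n : ℕ) : ℝ[X] :=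
  ∑ m ∈ Finset.range n, (φ (P m) / B (P m) (P m)) • P m

theorem reproducing_degree_lt {P : ℕ → ℝ[X]} {n : ℕ}
    (hP : ∀ m < n, IsMonicOrthogonal (fun p q => B p q) m (P m)) (φ : ℝ[X] →ₗ[ℝ] ℝ) :
    (reproducing B P φ n).degree < n := by
  rw [reproducing, ← mem_degreeLT]
  refine Submodule.sum_mem _ fun m hm => Submodule.smul_mem _ _ ?_
  rw [mem_degreeLT]
  exact (hP m (Finset.mem_range.1 hm)).degree_lt (Finset.mem_range.1 hm)

theorem reproducing_apply (hsymm : ∀ p q, B p q = B q p) (hpos : ∀ p, p ≠ 0 → 0 < B p p)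
    {P : ℕ → ℝ[X]} {n : ℕ} (hP : ∀ m < n, IsMonicOrthogonal (fun p q => B p q) m (P m))
    (φ : ℝ[X] →ₗ[ℝ] ℝ) {p : ℝ[X]} (hp : p.degree < n) :
    B (reproducing B P φ n) p = φ p := by
  conv_rhs => rw [eq_sum_orthogonal hsymm hpos hP hp]
  simp only [reproducing, map_sum, LinearMap.sum_apply, map_smul, LinearMap.smul_apply, smul_eq_mul]
  refine Finset.sum_congr rfl fun m _ => ?_
  rw [hsymm (P m) p]
  ring

/-- The kernel sum `∑_{m < n} φ(Pₘ) ψ(Pₘ) / hₘ`. -/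
noncomputable def kernelSum (B : LinearMap.BilinForm ℝ ℝ[X]) (P : ℕ → ℝ[X])
    (φ ψ : ℝ[X] →ₗ[ℝ] ℝ) (n : ℕ) : ℝ :=
  ∑ m ∈ Finset.range n, φ (P m) * ψ (P m) / B (P m) (P m)

theorem map_reproducing (P : ℕ → ℝ[X]) (φ ψ : ℝ[X] →ₗ[ℝ] ℝ) (n : ℕ) :
    ψ (reproducing B P φ n) = kernelSum B P φ ψ n := by
  simp only [reproducing, kernelSum, map_sum, map_smul, smul_eq_mul]
  exact Finset.sum_congr rfl fun m _ => by ring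

/-- `X * Pₙ` involves only `Pₙ₊₁`, `Pₙ` and `Pₙ₋₁`, with coefficient `hₙ / hₙ₋₁` at the last one;
here `X` may be translated by a constant `c`. -/
theorem three_term_recurrence (hsymm : ∀ p q, B p q = B q p) (hpos : ∀ p, p ≠ 0 → 0 < B p p)
    {P : ℕ → ℝ[X]} (hP : ∀ m, IsMonicOrthogonal (fun p q => B p q) m (P m)) (c : ℝ)
    (hmul : ∀ p q, B ((X + C c) * p) q = B p ((X + C c) * q)) (n : ℕ) :
    ∃ b : ℝ, (X + C c) * P (n + 1) = P (n + 2) + b • P (n + 1) +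
      (B (P (n + 1)) (P (n + 1)) / B (P n) (P n)) • P n := by
  have hmonic : ∀ m, ((X + C c) * P m).Monic := fun m => (monic_X_add_C c).mul (hP m).1
  have hnat : ∀ m, ((X + C c) * P m).natDegree = m + 1 := fun m => by
    rw [(monic_X_add_C c).natDegree_mul (hP m).1, natDegree_X_add_C, (hP m).2.1, add_comm]
  have hd := (hmonic (n + 1)).degree_sub_lt_natCast (hP (n + 2)).1 (hnat _) (hP _).2.1
  have h1 := eq_sum_orthogonal hsymm hpos (fun m _ => hP m) hd
  have h2 : ∀ m, m < n + 1 → B ((X + C c) * P (n + 1) - P (n + 2)) (P m) =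
      B (P (n + 1)) ((X + C c) * P m) := by
    intro m hm
    rw [map_sub, LinearMap.sub_apply, hmul, orthogonal_of_ne hsymm (hP _) (hP m) (by omega),
      sub_zero]
  -- `(X + C c) * P n` and `P (n + 1)` are monic of the same degree, so their difference is
  -- orthogonal to `P (n + 1)`.
  have h3 : B (P (n + 1)) ((X + C c) * P n) = B (P (n + 1)) (P (n + 1)) := by
    have h := (hmonic n).degree_sub_lt_natCast (hP (n + 1)).1 (hnat _) (hP _).2.1
    have h4 : B (P (n + 1)) ((X + C c) * P n - P (n + 1)) = 0 := (hP (n + 1)).2.2 _ h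
    rwa [map_sub, sub_eq_zero] at h4
  rw [Finset.sum_range_succ, Finset.sum_range_succ, Finset.sum_eq_zero, zero_add,
    h2 n n.lt_succ_self, h3] at h1
  · exact ⟨_, (sub_eq_iff_eq_add'.1 h1).trans (by rw [add_comm ((_ / _) • P n), ← add_assoc])⟩
  · intro m hm
    rw [Finset.mem_range] at hm
    have h5 : B (P (n + 1)) ((X + C c) * P m) = 0 := by
      refine (hP (n + 1)).2.2 _ (lt_of_le_of_lt degree_le_natDegree ?_)
      rw [hnat]
      exact_mod_cast Nat.succ_lt_succ hm
    rw [h2 m (by omega), h5, zero_div, zero_smul]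

end PositiveDefinite

/-! ### The Jacobi form and its differential operator -/

theorem intervalIntegrable_jacobi_weight {α β : ℝ} (hα : -1 < α) (hβ : -1 < β) :
    IntervalIntegrable (fun x : ℝ => (1 - x) ^ α * (1 + x) ^ β) MeasureTheory.volume (-1) 1 := by
  -- Splitting at 0 leaves one possibly singular factor on each half; the other is continuous there.
  have h1 : IntervalIntegrable (fun x : ℝ => (1 - x) ^ α * (1 + x) ^ β)
      MeasureTheory.volume (-1) 0 := by
    refine IntervalIntegrable.continuousOn_mul (f := fun x : ℝ => (1 + x) ^ β) ?_ ?_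
    · have := (intervalIntegral.intervalIntegrable_rpow' (a := 0) (b := 1) hβ).comp_add_left 1
      simpa using this
    · rw [Set.uIcc_of_le (by norm_num)]
      exact ContinuousOn.rpow_const (by fun_prop) fun x hx => Or.inl (by have := hx.2; linarith)
  have h2 : IntervalIntegrable (fun x : ℝ => (1 - x) ^ α * (1 + x) ^ β)
      MeasureTheory.volume 0 1 := by
    refine IntervalIntegrable.mul_continuousOn (f := fun x : ℝ => (1 - x) ^ α) ?_ ?_
    · have := (intervalIntegral.intervalIntegrable_rpow' (a := 1) (b := 0) hα).comp_sub_left 1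
      simpa using this
    · rw [Set.uIcc_of_le (by norm_num)]
      exact ContinuousOn.rpow_const (by fun_prop) fun x hx => Or.inl (by have := hx.1; linarith)
  exact h1.trans h2

theorem intervalIntegrable_eval_mul_jacobi_weight {α β : ℝ} (hα : -1 < α) (hβ : -1 < β)
    (p : ℝ[X]) :
    IntervalIntegrable (fun x : ℝ => p.eval x * ((1 - x) ^ α * (1 + x) ^ β))
      MeasureTheory.volume (-1) 1 :=
  (intervalIntegrable_jacobi_weight hα hβ).continuousOn_mul p.continuous.continuousOn

/-- Integration against the Jacobi weight, as a linear functional. -/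
noncomputable def jacobiFunctional {α β : ℝ} (hα : -1 < α) (hβ : -1 < β) : ℝ[X] →ₗ[ℝ] ℝ where
  toFun p := ∫ x in (-1 : ℝ)..1, p.eval x * ((1 - x) ^ α * (1 + x) ^ β)
  map_add' p q := by
    rw [← intervalIntegral.integral_add (intervalIntegrable_eval_mul_jacobi_weight hα hβ p)
      (intervalIntegrable_eval_mul_jacobi_weight hα hβ q)]
    simp only [eval_add, add_mul]
  map_smul' c p := by
    rw [RingHom.id_apply, smul_eq_mul, ← intervalIntegral.integral_const_mul]
    simp only [eval_smul, smul_eq_mul, mul_assoc]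

/-- `jacobiForm` as a bilinear form. -/
noncomputable def jacobiBilin {α β : ℝ} (hα : -1 < α) (hβ : -1 < β) :
    LinearMap.BilinForm ℝ ℝ[X] :=
  (LinearMap.mul ℝ ℝ[X]).compr₂ (jacobiFunctional hα hβ)

section Jacobi

variable {α β : ℝ} (hα : -1 < α) (hβ : -1 < β)

theorem jacobiBilin_eq_functional (p q : ℝ[X]) :
    jacobiBilin hα hβ p q = jacobiFunctional hα hβ (p * q) := rfl

theorem jacobiBilin_apply (p q : ℝ[X]) : jacobiBilin hα hβ p q = jacobiForm α β p q := by
  simp only [jacobiBilin_eq_functional, jacobiFunctional, jacobiForm, LinearMap.coe_mk,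
    AddHom.coe_mk, eval_mul]

theorem jacobiBilin_eq : (fun p q => jacobiBilin hα hβ p q) = jacobiForm α β := by
  funext p q
  exact jacobiBilin_apply hα hβ p q

theorem jacobiBilin_symm (p q : ℝ[X]) : jacobiBilin hα hβ p q = jacobiBilin hα hβ q p := by
  simp only [jacobiBilin_eq_functional, mul_comm]

theorem jacobiBilin_pos (p : ℝ[X]) (hp : p ≠ 0) : 0 < jacobiBilin hα hβ p p := by
  have hint := intervalIntegrable_eval_mul_jacobi_weight hα hβ (p * p)
  have h0 : ∀ x ∈ Set.Ioc (-1 : ℝ) 1, 0 ≤ (p * p).eval x * ((1 - x) ^ α * (1 + x) ^ β) := by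
    intro x hx
    rw [eval_mul]
    exact mul_nonneg (mul_self_nonneg _) (mul_nonneg (Real.rpow_nonneg (by linarith [hx.2]) _)
      (Real.rpow_nonneg (by linarith [hx.1]) _))
  show 0 < ∫ x in (-1 : ℝ)..1, (p * p).eval x * ((1 - x) ^ α * (1 + x) ^ β)
  rw [intervalIntegral.integral_pos_iff_support_of_nonneg_ae'
    (MeasureTheory.ae_restrict_of_forall_mem measurableSet_uIoc (by
      rw [Set.uIoc_of_le (by norm_num)]; exact h0)) hint]
  refine ⟨by norm_num, ?_⟩
  have hsub : Set.Ioo (-1 : ℝ) 1 \ {x | p.IsRoot x} ⊆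
      Function.support (fun x => (p * p).eval x * ((1 - x) ^ α * (1 + x) ^ β)) ∩
        Set.Ioc (-1) 1 := by
    intro x hx
    refine ⟨?_, hx.1.1, hx.1.2.le⟩
    have hr : p.eval x ≠ 0 := hx.2
    rw [Function.mem_support, eval_mul]
    exact mul_ne_zero (mul_ne_zero hr hr) (mul_ne_zero
      (Real.rpow_pos_of_pos (by linarith [hx.1.2]) _).ne'
      (Real.rpow_pos_of_pos (by linarith [hx.1.1]) _).ne')
  refine lt_of_lt_of_le ?_ (MeasureTheory.measure_mono hsub)
  rw [MeasureTheory.measure_sdiff_null ((finite_setOfPred_isRoot hp).measure_zero _)]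
  simp

/-- The Jacobi differential operator. -/
noncomputable def jacobiOperator (α β : ℝ) (p : ℝ[X]) : ℝ[X] :=
  (1 - X ^ 2) * derivative (derivative p) +
    (C (β - α) - C (α + β + 2) * X) * derivative p

/-- Lagrange's identity: the difference of the integrands is the derivative of (1-x)^(α+1)
(1+x)^(β+1) (p'q - pq'), which vanishes at ±1 because both exponents are positive. -/
theorem jacobiOperator_symm (p q : ℝ[X]) :
    jacobiBilin hα hβ (jacobiOperator α β p) q = jacobiBilin hα hβ p (jacobiOperator α β q) := by
  rw [← sub_eq_zero, jacobiBilin_eq_functional, jacobiBilin_eq_functional, ← map_sub]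
  have hF : ∀ x ∈ Set.Ioo (-1 : ℝ) 1, HasDerivAt
      (fun x => (1 - x) ^ (α + 1) * (1 + x) ^ (β + 1) *
        (derivative p * q - p * derivative q).eval x)
      ((jacobiOperator α β p * q - p * jacobiOperator α β q).eval x *
        ((1 - x) ^ α * (1 + x) ^ β)) x := by
    intro x hx
    have hx1 : 0 < 1 - x := by linarith [hx.2]
    have hx2 : 0 < 1 + x := by linarith [hx.1]
    have d1 : HasDerivAt (fun x : ℝ => (1 - x) ^ (α + 1)) (-1 * (α + 1) * (1 - x) ^ α) x := by
      have := ((hasDerivAt_id x).const_sub 1).rpow_const (p := α + 1) (Or.inl hx1.ne')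
      simpa using this
    have d2 : HasDerivAt (fun x : ℝ => (1 + x) ^ (β + 1)) (1 * (β + 1) * (1 + x) ^ β) x := by
      have := ((hasDerivAt_id x).const_add 1).rpow_const (p := β + 1) (Or.inl hx2.ne')
      simpa using this
    refine HasDerivAt.congr_deriv ((d1.mul d2).mul
      (Polynomial.hasDerivAt (derivative p * q - p * derivative q) x)) ?_
    rw [Pi.mul_apply, Real.rpow_add_one hx1.ne', Real.rpow_add_one hx2.ne']
    simp only [jacobiOperator, derivative_sub, derivative_mul, eval_sub, eval_add, eval_mul,
      eval_pow, eval_X, eval_C, eval_one]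
    ring
  have hc : ContinuousOn (fun x : ℝ => (1 - x) ^ (α + 1) * (1 + x) ^ (β + 1) *
        (derivative p * q - p * derivative q).eval x) (Set.Icc (-1) 1) := by
    refine ContinuousOn.mul (ContinuousOn.mul ?_ ?_) (Polynomial.continuous _).continuousOn
    · exact ContinuousOn.rpow_const (by fun_prop) fun x _ => Or.inr (by linarith)
    · exact ContinuousOn.rpow_const (by fun_prop) fun x _ => Or.inr (by linarith)
  refine (intervalIntegral.integral_eq_sub_of_hasDerivAt_of_le (by norm_num) hc hF
    (intervalIntegrable_eval_mul_jacobi_weight hα hβ _)).trans ?_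
  have hα' : α + 1 ≠ 0 := by linarith
  have hβ' : β + 1 ≠ 0 := by linarith
  simp [Real.zero_rpow hα', Real.zero_rpow hβ']

theorem jacobiOperator_coeff (p : ℝ[X]) (m : ℕ) (hm : p.natDegree ≤ m) :
    (jacobiOperator α β p).coeff m = -(m * (m + α + β + 1)) * p.coeff m := by
  have h : p.coeff (m + 1) = 0 := coeff_eq_zero_of_natDegree_lt (by omega)
  have h' : p.coeff (m + 2) = 0 := coeff_eq_zero_of_natDegree_lt (by omega)
  have hc : (m : ℝ) * (m + α + β + 1) = m * (m - 1) + m * (α + β + 2) := by ring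
  rw [hc]
  generalize hcd : α + β + 2 = c
  rcases m with _ | _ | m <;>
  simp [jacobiOperator, hcd, sub_mul, mul_assoc, coeff_X_mul, coeff_X_pow_mul',
    coeff_derivative, h, h']
  all_goals ring

theorem jacobiOperator_degree_lt (p : ℝ[X]) (n : ℕ) (hp : p.degree < n) :
    (jacobiOperator α β p).degree < n := by
  rw [degree_lt_iff_coeff_zero]
  intro m hm
  rw [jacobiOperator_coeff, coeff_eq_zero_of_degree_lt (hp.trans_le (by exact_mod_cast hm)),
    mul_zero]
  exact natDegree_le_of_degree_le (hp.le.trans (by exact_mod_cast hm))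

end Jacobi

/-- The eigenvalue is chosen to cancel the leading coefficient, so the defect d has degree < n. The
operator is symmetric and does not raise degrees, so ⟨d, d⟩ = ⟨P, Ld⟩ - λ⟨P, d⟩ = 0. -/
theorem jacobiOperator_eq {α β : ℝ} (hα : -1 < α) (hβ : -1 < β) {n : ℕ} {P : ℝ[X]}
    (hP : IsMonicOrthogonal (jacobiForm α β) n P) :
    jacobiOperator α β P = C (-(n * (n + α + β + 1))) * P := by
  rw [← jacobiBilin_eq hα hβ] at hP
  rw [← sub_eq_zero]
  by_contra hne
  have hdeg : (jacobiOperator α β P - C (-(n * (n + α + β + 1))) * P).degree < n := by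
    rw [degree_lt_iff_coeff_zero]
    intro m hm
    rcases hm.eq_or_lt with rfl | hm
    · rw [coeff_sub, jacobiOperator_coeff _ _ hP.2.1.le, coeff_C_mul, sub_self]
    · rw [coeff_sub, jacobiOperator_coeff _ _ (hP.2.1.le.trans hm.le), coeff_C_mul,
        coeff_eq_zero_of_natDegree_lt (hP.2.1.trans_lt hm)]
      simp
  set d := jacobiOperator α β P - C (-(n * (n + α + β + 1))) * P with hd
  refine (jacobiBilin_pos hα hβ d hne).ne' ?_
  have h1 : jacobiBilin hα hβ P d = 0 := hP.2.2 _ hdeg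
  have h2 : jacobiBilin hα hβ P (jacobiOperator α β d) = 0 :=
    hP.2.2 _ (jacobiOperator_degree_lt _ n hdeg)
  nth_rewrite 1 [hd]
  rw [LinearMap.map_sub₂, jacobiOperator_symm, h2, ← smul_eq_C_mul, LinearMap.map_smul₂, h1]
  simp

/-! ### Jacobi polynomials and their derivatives at -1 -/

theorem Polynomial.Monic.eval_iterate_derivative_natDegree {p : ℝ[X]} (hp : p.Monic) {n : ℕ}
    (hn : p.natDegree = n) (x : ℝ) : (derivative^[n] p).eval x = n.factorial := by
  have h0 : (derivative^[n] p).natDegree ≤ 0 := by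
    have := natDegree_iterate_derivative p n
    omega
  rw [eq_C_of_natDegree_le_zero h0, eval_C, coeff_iterate_derivative, zero_add,
    Nat.descFactorial_self]
  have h1 : p.coeff n = 1 := by rw [← hn]; exact hp
  simp [h1]

theorem finsetProd_natCast_sub_self (n : ℕ) :
    ∏ i ∈ Finset.range n, ((n : ℝ) - i) = n.factorial := by
  rw [Finset.prod_range_natCast_sub, ← Nat.descFactorial_eq_prod_range, Nat.descFactorial_self]

/-- The absolute value of the ratio of the `j`-th derivative at `-1` of the Jacobi polynomial of
degree `n` to its value at `-1`. -/
noncomputable def jacobiDerivRatio (α β : ℝ) (j n : ℕ) : ℝ :=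
  ∏ i ∈ Finset.range j, (((n : ℝ) - i) * (n + i + (α + β + 1)) / (2 * (β + 1 + i)))

/-- The polynomial `p` is the monic Jacobi polynomial of degree `n`, with parameters in range. -/
structure IsJacobi (α β : ℝ) (n : ℕ) (P : ℝ[X]) : Prop where
  left : -1 < α
  right : -1 < β
  orth : IsMonicOrthogonal (jacobiForm α β) n P

namespace IsJacobi

variable {α β : ℝ} {n : ℕ} {P : ℝ[X]}

theorem iterate_derivative_equation (hP : IsJacobi α β n P) (j : ℕ) :
    (1 - X ^ 2) * derivative^[j + 2] P +
      (C (β - α) - C (α + β + 2 + 2 * j) * X) * derivative^[j + 1] P +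
      C (n * (n + (α + β + 1)) - j * (j + (α + β + 1))) * derivative^[j] P = 0 := by
  induction j with
  | zero =>
    have h := jacobiOperator_eq hP.left hP.right hP.orth
    rw [jacobiOperator, ← sub_eq_zero] at h
    rw [← h]
    simp only [zero_add, Function.iterate_succ, Function.iterate_zero, Function.comp_apply, id_eq,
      Nat.cast_zero, zero_mul, mul_zero, add_zero, sub_zero, C_neg]
    rw [← add_assoc, ← add_assoc]
    ring
  | succ j ih =>
    have h := congrArg derivative ih
    simp only [derivative_add, derivative_mul, derivative_sub, derivative_C, derivative_X,
      derivative_one, derivative_X_pow, derivative_zero, ← Function.iterate_succ_apply'] at h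
    rw [← h]
    have e1 : C (n * (n + (α + β + 1)) - j * (j + (α + β + 1)) : ℝ) =
        C (n * (n + (α + β + 1)) - ((j + 1 : ℕ) : ℝ) * ((j + 1 : ℕ) + (α + β + 1))) +
        C (α + β + 2 + 2 * j) := by
      rw [← C_add]; congr 1; push_cast; ring
    have e2 : C (α + β + 2 + 2 * ((j + 1 : ℕ) : ℝ)) = C (α + β + 2 + 2 * j) + (2 : ℝ[X]) := by
      rw [← C_ofNat, ← C_add]; congr 1; push_cast; ring
    rw [e1, e2]
    have e3 : C ((2 : ℕ) : ℝ) = (2 : ℝ[X]) := by rw [Nat.cast_ofNat, C_ofNat]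
    rw [e3]
    simp only [Nat.succ_eq_add_one, add_assoc, Nat.reduceAdd, Nat.reduceSub, pow_one]
    ring

/-- At -1 the coefficient 1 - X² vanishes, so the differentiated equation becomes a first-order
recursion in j. -/
theorem eval_iterate_derivative_succ (hP : IsJacobi α β n P) (j : ℕ) :
    (derivative^[j + 1] P).eval (-1) =
      -(((n : ℝ) - j) * (n + j + (α + β + 1)) / (2 * (β + 1 + j))) *
        (derivative^[j] P).eval (-1) := by
  have h := congrArg (eval (-1)) (hP.iterate_derivative_equation j)
  simp only [eval_add, eval_mul, eval_sub, eval_one, eval_pow, eval_X, eval_C, eval_zero] at h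
  have hb : 2 * (β + 1 + j) ≠ 0 := by
    have := hP.right
    have : (0 : ℝ) ≤ j := j.cast_nonneg
    linarith
  rw [← neg_div, div_mul_eq_mul_div, eq_div_iff hb]
  linear_combination h

theorem eval_iterate_derivative (hP : IsJacobi α β n P) (j : ℕ) :
    (derivative^[j] P).eval (-1) = (-1) ^ j * jacobiDerivRatio α β j n * P.eval (-1) := by
  induction j with
  | zero => simp [jacobiDerivRatio]
  | succ j ih =>
    rw [hP.eval_iterate_derivative_succ, ih, jacobiDerivRatio, jacobiDerivRatio,
      Finset.prod_range_succ]
    ring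

theorem eval_derivative (hP : IsJacobi α β n P) :
    (derivative P).eval (-1) = -(n * (n + (α + β + 1)) / (2 * (β + 1))) * P.eval (-1) := by
  have := hP.eval_iterate_derivative_succ 0
  simpa using this

theorem eval_ne_zero (hP : IsJacobi α β n P) : P.eval (-1) ≠ 0 := by
  intro h
  have h1 := hP.eval_iterate_derivative n
  rw [hP.orth.1.eval_iterate_derivative_natDegree hP.orth.2.1, h, mul_zero] at h1
  exact n.factorial_ne_zero (by exact_mod_cast h1)

/-- The case j = n of `eval_iterate_derivative`: the n-th derivative is n!, which cancels the
factors n - i. This replaces Rodrigues' formula. -/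
theorem eval_mul_prod (hP : IsJacobi α β n P) :
    P.eval (-1) * ∏ i ∈ Finset.range n, ((n : ℝ) + i + (α + β + 1)) =
      (-2) ^ n * ∏ i ∈ Finset.range n, (β + 1 + i) := by
  have h1 := hP.eval_iterate_derivative n
  rw [hP.orth.1.eval_iterate_derivative_natDegree hP.orth.2.1, jacobiDerivRatio,
    Finset.prod_div_distrib, Finset.prod_mul_distrib, Finset.prod_mul_distrib,
    finsetProd_natCast_sub_self, Finset.prod_const, Finset.card_range] at h1
  have hf : (n.factorial : ℝ) ≠ 0 := by exact_mod_cast n.factorial_ne_zero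
  have hb : ∏ i ∈ Finset.range n, (β + 1 + (i : ℝ)) ≠ 0 := by
    refine Finset.prod_ne_zero_iff.2 fun i _ => ?_
    have := hP.right
    have : (0 : ℝ) ≤ i := i.cast_nonneg
    linarith
  have hs : ((-1 : ℝ) ^ n) * (-1) ^ n = 1 := by rw [← mul_pow]; simp
  have h2 : (-2 : ℝ) ^ n = (-1) ^ n * 2 ^ n := by rw [← mul_pow]; norm_num
  field_simp at h1
  rw [h2]
  linear_combination (-(-1) ^ n) * h1 -
    (P.eval (-1) * ∏ i ∈ Finset.range n, ((n : ℝ) + i + (α + β + 1))) * hs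

theorem eval_succ (hP : IsJacobi α β n P) {P' : ℝ[X]} (hP' : IsJacobi α β (n + 1) P') :
    P'.eval (-1) * ((2 * n + (α + β + 1)) * (2 * n + 1 + (α + β + 1))) =
      -2 * (β + 1 + n) * (n + (α + β + 1)) * P.eval (-1) := by
  have h := hP.eval_mul_prod
  have h' := hP'.eval_mul_prod
  rw [pow_succ, Finset.prod_range_succ (fun i : ℕ => β + 1 + (i : ℝ))] at h'
  -- Both sides are ∏_{i<n+2} (n + i + α+β+1). The extra factor is kept as a multiplier because it
  -- may vanish at n = 0.
  have hW : ((n : ℝ) + (α + β + 1)) *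
      ∏ i ∈ Finset.range (n + 1), (((n + 1 : ℕ) : ℝ) + i + (α + β + 1)) =
      (∏ i ∈ Finset.range n, ((n : ℝ) + i + (α + β + 1))) *
        ((2 * n + (α + β + 1)) * (2 * n + 1 + (α + β + 1))) := by
    have h1 := Finset.prod_range_succ' (fun i : ℕ => (n : ℝ) + i + (α + β + 1)) (n + 1)
    rw [Finset.prod_range_succ, Finset.prod_range_succ] at h1
    push_cast at h1 ⊢
    have h2 : ∀ i : ℕ, (n : ℝ) + 1 + i + (α + β + 1) = n + (i + 1) + (α + β + 1) := by
      intro i; ring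
    simp only [h2]
    linear_combination -h1
  have hW0 : ∏ i ∈ Finset.range n, ((n : ℝ) + i + (α + β + 1)) ≠ 0 := by
    refine Finset.prod_ne_zero_iff.2 fun i hi => ?_
    have h1 : (1 : ℝ) ≤ n := by
      have := Finset.mem_range.1 hi
      exact_mod_cast (by omega : 1 ≤ n)
    have := hP.right
    have := hP.left
    have : (0 : ℝ) ≤ i := i.cast_nonneg
    linarith
  refine mul_left_cancel₀ hW0 ?_
  linear_combination -P'.eval (-1) * hW + ((n : ℝ) + (α + β + 1)) * h' +
    (2 * (β + 1 + n) * (n + (α + β + 1))) * h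

end IsJacobi

/-! ### Ratios of norms and of normalized squares -/

/-- The value at `-1` of the square of the orthonormal polynomial of degree `n`, for the monic
orthogonal polynomials `P` of the form `B`. -/
noncomputable def normalizedSq (B : LinearMap.BilinForm ℝ ℝ[X]) (P : ℕ → ℝ[X]) (n : ℕ) : ℝ :=
  (P n).eval (-1) ^ 2 / B (P n) (P n)

/-- The recurrence for (X+1) P_{n+1} and its derivative, both taken at -1, are two linear equations
in the unknown coefficients b and h_{n+1}/h_n. Expressing P'(-1) through P(-1) and eliminating b
gives the ratio without computing any integral. -/
theorem jacobi_norm_ratio {α β : ℝ} (hα : -1 < α) (hβ : -1 < β) {P : ℕ → ℝ[X]}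
    (hP : ∀ n, IsJacobi α β n (P n)) (n : ℕ) :
    jacobiBilin hα hβ (P (n + 1)) (P (n + 1)) / jacobiBilin hα hβ (P n) (P n) *
      (2 * n + 1 + (α + β + 1)) * (P n).eval (-1) = 2 * (β + 1) * (P (n + 1)).eval (-1) +
      (2 * n + 3 + (α + β + 1)) * (P (n + 2)).eval (-1) := by
  obtain ⟨b, hb⟩ := three_term_recurrence (jacobiBilin_symm hα hβ) (jacobiBilin_pos hα hβ)
    (fun m => (jacobiBilin_eq hα hβ).symm ▸ (hP m).orth) 1
    (fun p q => by rw [jacobiBilin_eq_functional, jacobiBilin_eq_functional]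
                   exact congrArg _ (by ring)) n
  generalize jacobiBilin hα hβ (P (n + 1)) (P (n + 1)) / jacobiBilin hα hβ (P n) (P n) = a at *
  have h1 := congrArg (eval (-1)) hb
  have h2 := congrArg (fun p => (derivative p).eval (-1)) hb
  simp only [eval_add, eval_mul, eval_smul, smul_eq_mul, eval_X, eval_C, derivative_add,
    derivative_mul, derivative_smul, derivative_X, derivative_C, (hP _).eval_derivative,
    eval_one, eval_zero] at h1 h2
  have hb0 : β + 1 ≠ 0 := by linarith
  push_cast at h1 h2
  field_simp at h2
  linear_combination -(n + 1 : ℝ) * (n + 1 + (α + β + 1)) * h1 - h2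

/-- The right side is arranged as factors (n + a)/(n + b), ready for
`OneAddDivAsymptotic.add_const_div`. With 1 ≤ n no denominator vanishes. -/
theorem normalizedSq_ratio {α β : ℝ} (hα : -1 < α) (hβ : -1 < β) {P : ℕ → ℝ[X]}
    (hP : ∀ n, IsJacobi α β n (P n)) {n : ℕ} (hn : 1 ≤ n) :
    normalizedSq (jacobiBilin hα hβ) P (n + 1) / normalizedSq (jacobiBilin hα hβ) P n =
      (n + (β + 1)) / (n + 1) * ((n + (α + β + 1)) / (n + (α + 1))) *
        ((n + (1 + (α + β + 1) / 2)) / (n + (α + β + 1) / 2)) := by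
  have hn' : (1 : ℝ) ≤ n := by exact_mod_cast hn
  have h := jacobi_norm_ratio hα hβ hP n
  have e1 := (hP n).eval_succ (hP (n + 1))
  have e2 := (hP (n + 1)).eval_succ (hP (n + 2))
  have p0 := (hP n).eval_ne_zero
  have p1 := (hP (n + 1)).eval_ne_zero
  have n0 := (jacobiBilin_pos hα hβ _ (hP n).orth.1.ne_zero).ne'
  have n1 := (jacobiBilin_pos hα hβ _ (hP (n + 1)).orth.1.ne_zero).ne'
  rw [normalizedSq, normalizedSq]
  generalize jacobiBilin hα hβ (P (n + 1)) (P (n + 1)) = h1 at *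
  generalize jacobiBilin hα hβ (P n) (P n) = h0 at *
  generalize (P (n + 1)).eval (-1) = x1 at *
  generalize (P n).eval (-1) = x0 at *
  generalize (P (n + 2)).eval (-1) = x2 at *
  obtain ⟨γ, hγ⟩ : ∃ γ, γ = α + β + 1 := ⟨_, rfl⟩
  rw [← hγ] at h e1 e2 ⊢
  have q1 : (n : ℝ) + γ ≠ 0 := by linarith
  have q2 : 2 * (n : ℝ) + γ ≠ 0 := by linarith
  have q3 : 2 * (n : ℝ) + 1 + γ ≠ 0 := by linarith
  have q4 : (n : ℝ) + (α + 1) ≠ 0 := by linarith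
  have q5 : (n : ℝ) + 1 ≠ 0 := by linarith
  have q6 : 2 * (n : ℝ) + 2 + γ ≠ 0 := by linarith
  have q7 : 2 * (n : ℝ) + 3 + γ ≠ 0 := by linarith
  have q8 : β + 1 + (n : ℝ) ≠ 0 := by linarith
  have q9 : (n : ℝ) + γ / 2 ≠ 0 := by intro h; apply q2; linarith
  push_cast at e2
  have a0 : h1 / h0 = -2 * (n + 1) * (n + (α + 1)) * x1 /
      ((2 * n + 1 + γ) * (2 * n + 2 + γ) * x0) := by
    rw [eq_div_iff (by positivity)]
    linear_combination (2 * n + 2 + γ) * h + e2 - 2 * x1 * (n + 1) * hγ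
  have a1 : x1 / x0 = -2 * (β + 1 + n) * (n + γ) / ((2 * n + γ) * (2 * n + 1 + γ)) := by
    rw [div_eq_div_iff p0 (by positivity)]
    linear_combination e1
  have a2 : x1 ^ 2 / h1 / (x0 ^ 2 / h0) = (x1 / x0) ^ 2 / (h1 / h0) := by
    field_simp
  have a3 : (x1 / x0) ^ 2 / (h1 / h0) =
      (x1 / x0) * ((2 * n + 1 + γ) * (2 * n + 2 + γ)) / (-2 * (n + 1) * (n + (α + 1))) := by
    rw [a0]
    field_simp
  rw [a2, a3, a1]
  field_simp
  ring

/-! ### Asymptotics from ratios of consecutive terms -/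

/-- `u n = 1 + s / n + o(1 / n)`. -/
def OneAddDivAsymptotic (u : ℕ → ℝ) (s : ℝ) : Prop :=
  Tendsto (fun n : ℕ => (n : ℝ) * (u n - 1)) atTop (𝓝 s)

namespace OneAddDivAsymptotic

variable {u v : ℕ → ℝ} {s t : ℝ}

theorem tendsto_one (hu : OneAddDivAsymptotic u s) : Tendsto u atTop (𝓝 1) := by
  have h : Tendsto (fun n : ℕ => (n : ℝ) * (u n - 1) * (n : ℝ)⁻¹ + 1) atTop (𝓝 (s * 0 + 1)) :=
    (Tendsto.mul hu tendsto_inv_atTop_nhds_zero_nat).add_const 1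
  rw [mul_zero, zero_add] at h
  refine h.congr' ?_
  filter_upwards [eventually_ne_atTop 0] with n hn
  have : (n : ℝ) ≠ 0 := by exact_mod_cast hn
  field_simp
  ring

theorem mul (hu : OneAddDivAsymptotic u s) (hv : OneAddDivAsymptotic v t) :
    OneAddDivAsymptotic (fun n => u n * v n) (s + t) := by
  have h := (Tendsto.mul hu hv.tendsto_one).add hv
  rw [mul_one] at h
  refine Tendsto.congr (fun n => ?_) h
  ring

theorem congr' (hu : OneAddDivAsymptotic u s) (huv : u =ᶠ[atTop] v) : OneAddDivAsymptotic v s :=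
  Tendsto.congr' (huv.mono fun n hn => by simp only [hn]) hu

theorem add_const_div (a b : ℝ) :
    OneAddDivAsymptotic (fun n : ℕ => ((n : ℝ) + a) / (n + b)) (a - b) := by
  have h1 : Tendsto (fun n : ℕ => (n : ℝ) + b) atTop atTop :=
    tendsto_atTop_add_const_right _ _ tendsto_natCast_atTop_atTop
  have h2 : Tendsto (fun n : ℕ => (a - b) * (1 - b * ((n : ℝ) + b)⁻¹)) atTop
      (𝓝 ((a - b) * (1 - b * 0))) :=
    ((h1.inv_tendsto_atTop.const_mul b).const_sub 1).const_mul (a - b)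
  rw [mul_zero, sub_zero, mul_one] at h2
  refine h2.congr' ?_
  filter_upwards [h1.eventually_ne_atTop 0] with n hn
  field_simp
  ring

theorem one : OneAddDivAsymptotic (fun _ => 1) 0 := by
  simp [OneAddDivAsymptotic]

theorem prod {ι : Type*} (S : Finset ι) {w : ι → ℕ → ℝ} {r : ι → ℝ}
    (h : ∀ i ∈ S, OneAddDivAsymptotic (w i) (r i)) :
    OneAddDivAsymptotic (fun n => ∏ i ∈ S, w i n) (∑ i ∈ S, r i) := by
  classical
  induction S using Finset.induction_on with
  | empty => simpa using one
  | insert a S ha ih =>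
    simp only [Finset.prod_insert ha, Finset.sum_insert ha]
    exact (h _ (Finset.mem_insert_self _ _)).mul
      (ih fun i hi => h i (Finset.mem_insert_of_mem hi))

end OneAddDivAsymptotic

section Stolz

variable {f t : ℕ → ℝ} {s : ℝ}

/-- Since s > 0, f is eventually increasing, so t n ≥ f N / n and the harmonic series forces
divergence. -/
theorem tendsto_sum_atTop_of_oneAddDivAsymptotic (hs : 0 < s) (hf : ∀ᶠ n in atTop, 0 < f n)
    (hfs : OneAddDivAsymptotic (fun n => f (n + 1) / f n) s) (ht : ∀ n, 0 ≤ t n)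
    (hft : ∀ᶠ n : ℕ in atTop, (n : ℝ) * t n = f n) :
    Tendsto (fun n => ∑ m ∈ Finset.range n, t m) atTop atTop := by
  rw [← not_summable_iff_tendsto_nat_atTop_of_nonneg ht]
  intro hsum
  have hev := ((Tendsto.eventually_const_lt hs hfs).and (hf.and hft)).and (eventually_gt_atTop 0)
  obtain ⟨N, hN⟩ := eventually_atTop.1 hev
  have hmono : ∀ n, N ≤ n → f N ≤ f n := by
    intro n hn
    induction n, hn using Nat.le_induction with
    | base => exact le_rfl
    | succ n hn ih =>
      obtain ⟨⟨h1, h2, -⟩, h3⟩ := hN n hn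
      have h4 : 0 < f (n + 1) / f n - 1 := pos_of_mul_pos_right h1 n.cast_nonneg
      rw [sub_pos, one_lt_div h2] at h4
      exact ih.trans h4.le
  have h1 : Summable (fun n : ℕ => f N * ((n + N : ℕ) : ℝ)⁻¹) := by
    refine Summable.of_nonneg_of_le (fun n => ?_) (fun n => ?_) ((summable_nat_add_iff N).2 hsum)
    · have := (hN N le_rfl).1.2.1
      positivity
    · have h := hN (n + N) (Nat.le_add_left _ _)
      have hpos : (0 : ℝ) < ((n + N : ℕ) : ℝ) := by exact_mod_cast h.2
      rw [← div_eq_mul_inv, div_le_iff₀ hpos, mul_comm, h.1.2.2]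
      exact hmono _ (Nat.le_add_left _ _)
  have h2 := (summable_mul_left_iff (hN N le_rfl).1.2.1.ne').1 h1
  exact Real.not_summable_natCast_inv ((summable_nat_add_iff N).1 h2)

/-- Stolz–Cesàro: the hypothesis says f(n+1) - f(n) = (s + o(1)) t(n). Summing is legitimate because
∑ t diverges, and the left side telescopes. -/
theorem tendsto_sum_div_of_oneAddDivAsymptotic (hs : 0 < s) (hf : ∀ᶠ n in atTop, 0 < f n)
    (hfs : OneAddDivAsymptotic (fun n => f (n + 1) / f n) s) (ht : ∀ n, 0 ≤ t n)
    (hft : ∀ᶠ n : ℕ in atTop, (n : ℝ) * t n = f n) :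
    Tendsto (fun n => (∑ m ∈ Finset.range n, t m) / f n) atTop (𝓝 s⁻¹) := by
  have hS := tendsto_sum_atTop_of_oneAddDivAsymptotic hs hf hfs ht hft
  have ho : (fun n => f (n + 1) - f n - s * t n) =o[atTop] t := by
    rw [Asymptotics.isLittleO_iff_tendsto']
    · have h1 : Tendsto (fun n : ℕ => (n : ℝ) * (f (n + 1) / f n - 1) - s) atTop (𝓝 (s - s)) :=
        Tendsto.sub_const hfs s
      rw [sub_self] at h1
      refine h1.congr' ?_
      filter_upwards [hf, hft, eventually_gt_atTop 0] with n h1 h2 h3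
      have h3' : (0 : ℝ) < n := by exact_mod_cast h3
      have h4 : t n = f n / n := by rw [← h2]; field_simp
      rw [h4]
      field_simp
    · filter_upwards [hf, hft] with n h1 h2 h3
      rw [h3, mul_zero] at h2
      exact absurd h2 h1.ne
  have h1 := (ho.sum_range ht hS).tendsto_div_nhds_zero
  have h2 : Tendsto (fun n => f 0 / ∑ m ∈ Finset.range n, t m) atTop (𝓝 0) :=
    hS.const_div_atTop (f 0)
  have h3 := (h1.add h2).add_const s
  simp only [zero_add] at h3
  have h4 : Tendsto (fun n => f n / ∑ m ∈ Finset.range n, t m) atTop (𝓝 s) := by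
    refine h3.congr' ?_
    filter_upwards [hS.eventually_gt_atTop 0] with n hn
    rw [Finset.sum_sub_distrib, Finset.sum_range_sub, ← Finset.mul_sum]
    field_simp
    ring
  simpa only [inv_div] using h4.inv₀ hs.ne'

theorem tendsto_atTop_of_oneAddDivAsymptotic (hs : 0 < s) (hf : ∀ᶠ n in atTop, 0 < f n)
    (hfs : OneAddDivAsymptotic (fun n => f (n + 1) / f n) s) (ht : ∀ n, 0 ≤ t n)
    (hft : ∀ᶠ n : ℕ in atTop, (n : ℝ) * t n = f n) : Tendsto f atTop atTop := by
  have h1 := tendsto_sum_atTop_of_oneAddDivAsymptotic hs hf hfs ht hft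
  have h2 := (tendsto_sum_div_of_oneAddDivAsymptotic hs hf hfs ht hft).inv₀ (inv_pos.2 hs).ne'
  rw [inv_inv] at h2
  refine (h1.atTop_mul_pos hs h2).congr' ?_
  filter_upwards [h1.eventually_gt_atTop 0] with n hn
  field_simp

end Stolz

/-! ### Perturbing a form by two rank-one terms -/

section Perturbation

variable {B : LinearMap.BilinForm ℝ ℝ[X]} {P : ℕ → ℝ[X]} {φ ψ : ℝ[X] →ₗ[ℝ] ℝ} {M N : ℝ} {n : ℕ}

/-- The form `B` perturbed by the squares of two linear functionals. -/
noncomputable def perturbedForm (B : LinearMap.BilinForm ℝ ℝ[X]) (φ ψ : ℝ[X] →ₗ[ℝ] ℝ)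
    (M N : ℝ) (p q : ℝ[X]) : ℝ :=
  B p q + M * φ p * φ q + N * ψ p * ψ q

theorem eq_of_isMonicOrthogonal_perturbedForm (hsymm : ∀ p q, B p q = B q p)
    (hpos : ∀ p, p ≠ 0 → 0 < B p p) (hP : ∀ m, IsMonicOrthogonal (fun p q => B p q) m (P m))
    {q : ℝ[X]} (hq : IsMonicOrthogonal (perturbedForm B φ ψ M N) n q) :
    q = P n - (M * φ q) • reproducing B P φ n - (N * ψ q) • reproducing B P ψ n := by
  have hP' : ∀ m < n, IsMonicOrthogonal (fun p q => B p q) m (P m) := fun m _ => hP m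
  rw [← sub_eq_zero]
  set d := q - (P n - (M * φ q) • reproducing B P φ n - (N * ψ q) • reproducing B P ψ n) with hd
  have hdeg : d.degree < n := by
    have h1 : d = (q - P n) + (M * φ q) • reproducing B P φ n +
        (N * ψ q) • reproducing B P ψ n := by rw [hd]; abel
    rw [h1, ← mem_degreeLT]
    refine Submodule.add_mem _ (Submodule.add_mem _ ?_ (Submodule.smul_mem _ _ ?_))
      (Submodule.smul_mem _ _ ?_) <;> rw [mem_degreeLT]
    · exact hq.1.degree_sub_lt_natCast (hP n).1 hq.2.1 (hP n).2.1
    · exact reproducing_degree_lt hP' φ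
    · exact reproducing_degree_lt hP' ψ
  by_contra hne
  refine (hpos d hne).ne' ?_
  have h1 : B q d + M * φ q * φ d + N * ψ q * ψ d = 0 := hq.2.2 d hdeg
  have h2 : B (P n) d = 0 := (hP n).2.2 d hdeg
  have h3 := reproducing_apply hsymm hpos hP' φ hdeg
  have h4 := reproducing_apply hsymm hpos hP' ψ hdeg
  nth_rewrite 1 [hd]
  simp only [LinearMap.map_sub₂, LinearMap.map_smul₂, h2, h3, h4, smul_eq_mul]
  linear_combination h1

/-- Converse of the preceding formula: a self-consistent pair (u, v) produces an orthogonal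
polynomial. This gives existence even when the perturbed form is indefinite. -/
theorem isMonicOrthogonal_perturbedForm (hsymm : ∀ p q, B p q = B q p)
    (hpos : ∀ p, p ≠ 0 → 0 < B p p) (hP : ∀ m, IsMonicOrthogonal (fun p q => B p q) m (P m))
    {u v : ℝ} {q : ℝ[X]}
    (hq : q = P n - (M * u) • reproducing B P φ n - (N * v) • reproducing B P ψ n)
    (hu : φ q = u) (hv : ψ q = v) : IsMonicOrthogonal (perturbedForm B φ ψ M N) n q := by
  have hP' : ∀ m < n, IsMonicOrthogonal (fun p q => B p q) m (P m) := fun m _ => hP m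
  have hdeg : ((M * u) • reproducing B P φ n + (N * v) • reproducing B P ψ n).degree <
      (P n).degree := by
    rw [degree_eq_natDegree (hP n).1.ne_zero, (hP n).2.1, ← mem_degreeLT]
    refine Submodule.add_mem _ (Submodule.smul_mem _ _ ?_)
      (Submodule.smul_mem _ _ ?_) <;> rw [mem_degreeLT]
    · exact reproducing_degree_lt hP' φ
    · exact reproducing_degree_lt hP' ψ
  refine ⟨?_, ?_, fun p hp => ?_⟩
  · rw [hq, sub_sub]
    exact (hP n).1.sub_of_left hdeg
  · rw [hq, sub_sub, natDegree_eq_of_degree_eq (degree_sub_eq_left_of_degree_lt hdeg), (hP n).2.1]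
  · rw [perturbedForm, hu, hv, hq]
    have h2 : B (P n) p = 0 := (hP n).2.2 p hp
    have h3 := reproducing_apply hsymm hpos hP' φ hp
    have h4 := reproducing_apply hsymm hpos hP' ψ hp
    simp only [LinearMap.map_sub₂, LinearMap.map_smul₂, h2, h3, h4, smul_eq_mul]
    ring

theorem kernelSum_comm : kernelSum B P ψ φ n = kernelSum B P φ ψ n := by
  simp only [kernelSum, mul_comm]

/-- The determinant of the linear system for `(φ q, ψ q)`, where `q` is the monic orthogonal
polynomial of the perturbed form. -/
noncomputable def perturbationDet (B : LinearMap.BilinForm ℝ ℝ[X]) (P : ℕ → ℝ[X])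
    (φ ψ : ℝ[X] →ₗ[ℝ] ℝ) (M N : ℝ) (n : ℕ) : ℝ :=
  (1 + M * kernelSum B P φ φ n) * (1 + N * kernelSum B P ψ ψ n) -
    M * N * kernelSum B P φ ψ n ^ 2

/-- Cramer's rule for the system obtained by applying φ and ψ to the formula for q. -/
theorem perturbed_values (hsymm : ∀ p q, B p q = B q p)
    (hpos : ∀ p, p ≠ 0 → 0 < B p p) (hP : ∀ m, IsMonicOrthogonal (fun p q => B p q) m (P m))
    (hD : perturbationDet B P φ ψ M N n ≠ 0)
    {q : ℝ[X]} (hq : IsMonicOrthogonal (perturbedForm B φ ψ M N) n q) :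
    φ q = (φ (P n) * (1 + N * kernelSum B P ψ ψ n) - N * kernelSum B P φ ψ n * ψ (P n)) /
        perturbationDet B P φ ψ M N n ∧
    ψ q = (ψ (P n) * (1 + M * kernelSum B P φ φ n) - M * kernelSum B P φ ψ n * φ (P n)) /
        perturbationDet B P φ ψ M N n := by
  have h := eq_of_isMonicOrthogonal_perturbedForm hsymm hpos hP hq
  have h1 := congrArg φ h
  have h2 := congrArg ψ h
  simp only [map_sub, map_smul, smul_eq_mul, map_reproducing] at h1 h2
  rw [kernelSum_comm (φ := φ) (ψ := ψ)] at h1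
  rw [eq_div_iff hD, eq_div_iff hD, perturbationDet]
  constructor
  · linear_combination (1 + N * kernelSum B P ψ ψ n) * h1 - N * kernelSum B P φ ψ n * h2
  · linear_combination (1 + M * kernelSum B P φ φ n) * h2 - M * kernelSum B P φ ψ n * h1

theorem existsUnique_perturbed (hsymm : ∀ p q, B p q = B q p)
    (hpos : ∀ p, p ≠ 0 → 0 < B p p) (hP : ∀ m, IsMonicOrthogonal (fun p q => B p q) m (P m))
    (hD : perturbationDet B P φ ψ M N n ≠ 0) :
    ∃! q, IsMonicOrthogonal (perturbedForm B φ ψ M N) n q := by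
  have hc : kernelSum B P ψ φ n = kernelSum B P φ ψ n := kernelSum_comm
  refine existsUnique_of_exists_of_unique ?_ fun q r hq hr => ?_
  · refine ⟨_, isMonicOrthogonal_perturbedForm hsymm hpos hP
      (u := (φ (P n) * (1 + N * kernelSum B P ψ ψ n) - N * kernelSum B P φ ψ n * ψ (P n)) /
        perturbationDet B P φ ψ M N n)
      (v := (ψ (P n) * (1 + M * kernelSum B P φ φ n) - M * kernelSum B P φ ψ n * φ (P n)) /
        perturbationDet B P φ ψ M N n) rfl ?_ ?_⟩ <;>
    · simp only [map_sub, map_smul, smul_eq_mul, map_reproducing, hc]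
      field_simp
      rw [perturbationDet]
      ring
  · rw [eq_of_isMonicOrthogonal_perturbedForm hsymm hpos hP hq,
      eq_of_isMonicOrthogonal_perturbedForm hsymm hpos hP hr,
      (perturbed_values hsymm hpos hP hD hq).1, (perturbed_values hsymm hpos hP hD hq).2,
      (perturbed_values hsymm hpos hP hD hr).1, (perturbed_values hsymm hpos hP hD hr).2]

end Perturbation

/-! ### Asymptotics of the kernel sums at -1 -/

section JacobiAsymptotics

variable {α β : ℝ}

theorem jacobiDerivRatio_nonneg (hα : -1 < α) (hβ : -1 < β) (j n : ℕ) :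
    0 ≤ jacobiDerivRatio α β j n := by
  rcases lt_or_ge n j with h | h
  -- The factor with i = n is zero.
  · rw [jacobiDerivRatio, Finset.prod_eq_zero (Finset.mem_range.2 h) (by simp)]
  · refine Finset.prod_nonneg fun i hi => ?_
    have hi' : (i : ℝ) + 1 ≤ n := by
      have := Finset.mem_range.1 hi
      exact_mod_cast (by omega : i + 1 ≤ n)
    have hi0 : (0 : ℝ) ≤ i := i.cast_nonneg
    exact div_nonneg (mul_nonneg (by linarith) (by linarith)) (by linarith)

theorem jacobiDerivRatio_pos (hα : -1 < α) (hβ : -1 < β) {j n : ℕ} (h : j ≤ n) :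
    0 < jacobiDerivRatio α β j n := by
  refine Finset.prod_pos fun i hi => ?_
  have hi' : (i : ℝ) + 1 ≤ n := by
    have := Finset.mem_range.1 hi
    exact_mod_cast (by omega : i + 1 ≤ n)
  have hi0 : (0 : ℝ) ≤ i := i.cast_nonneg
  exact div_pos (mul_pos (by linarith) (by linarith)) (by linarith)

theorem oneAddDivAsymptotic_jacobiDerivRatio (hβ : -1 < β) (j : ℕ) :
    OneAddDivAsymptotic (fun n => jacobiDerivRatio α β j (n + 1) / jacobiDerivRatio α β j n)
      (2 * j) := by
  have h := OneAddDivAsymptotic.prod (Finset.range j) fun i _ =>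
    (OneAddDivAsymptotic.add_const_div (1 - i) (-i)).mul
      (OneAddDivAsymptotic.add_const_div (1 + i + (α + β + 1)) (i + (α + β + 1)))
  have e : ∑ i ∈ Finset.range j, ((1 - (i : ℝ) - -i) +
      (1 + i + (α + β + 1) - (i + (α + β + 1)))) = 2 * j := by
    rw [Finset.sum_congr rfl fun i _ => (by ring : _ = (2 : ℝ))]
    simp [mul_comm]
  rw [e] at h
  refine h.congr' (Eventually.of_forall fun n => ?_)
  simp only [jacobiDerivRatio, ← Finset.prod_div_distrib]
  refine Finset.prod_congr rfl fun i _ => ?_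
  have hi0 : (0 : ℝ) ≤ i := i.cast_nonneg
  rw [div_div_div_cancel_right₀ (by linarith), ← div_mul_div_comm]
  push_cast
  congr 2 <;> ring

variable (hα : -1 < α) (hβ : -1 < β) {P : ℕ → ℝ[X]}

theorem normalizedSq_pos (hP : ∀ n, IsJacobi α β n (P n)) (n : ℕ) :
    0 < normalizedSq (jacobiBilin hα hβ) P n :=
  div_pos (sq_pos_iff.2 (hP n).eval_ne_zero)
    (jacobiBilin_pos hα hβ _ (hP n).orth.1.ne_zero)

theorem oneAddDivAsymptotic_normalizedSq (hP : ∀ n, IsJacobi α β n (P n)) :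
    OneAddDivAsymptotic (fun n => normalizedSq (jacobiBilin hα hβ) P (n + 1) /
      normalizedSq (jacobiBilin hα hβ) P n) (2 * β + 1) := by
  have h := ((OneAddDivAsymptotic.add_const_div (β + 1) 1).mul
    (OneAddDivAsymptotic.add_const_div (α + β + 1) (α + 1))).mul
    (OneAddDivAsymptotic.add_const_div (1 + (α + β + 1) / 2) ((α + β + 1) / 2))
  rw [show β + 1 - 1 + (α + β + 1 - (α + 1)) + (1 + (α + β + 1) / 2 - (α + β + 1) / 2) =
    2 * β + 1 by ring] at h
  refine h.congr' ?_
  filter_upwards [eventually_ge_atTop 1] with n hn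
  exact (normalizedSq_ratio hα hβ hP hn).symm

/-- The general term of the kernel sums, up to sign. -/
noncomputable def kernelTerm (P : ℕ → ℝ[X]) (i j n : ℕ) : ℝ :=
  normalizedSq (jacobiBilin hα hβ) P n * (jacobiDerivRatio α β i n * jacobiDerivRatio α β j n)

theorem kernelTerm_nonneg (hP : ∀ n, IsJacobi α β n (P n)) (i j n : ℕ) :
    0 ≤ kernelTerm hα hβ P i j n :=
  mul_nonneg (normalizedSq_pos hα hβ hP n).le
    (mul_nonneg (jacobiDerivRatio_nonneg hα hβ i n) (jacobiDerivRatio_nonneg hα hβ j n))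

theorem eventually_kernelTerm_pos (hP : ∀ n, IsJacobi α β n (P n)) (i j : ℕ) :
    ∀ᶠ n : ℕ in atTop, 0 < n * kernelTerm hα hβ P i j n := by
  filter_upwards [eventually_ge_atTop i, eventually_ge_atTop j, eventually_gt_atTop 0]
    with n hi hj hn
  exact mul_pos (by exact_mod_cast hn) (mul_pos (normalizedSq_pos hα hβ hP n)
    (mul_pos (jacobiDerivRatio_pos hα hβ hi) (jacobiDerivRatio_pos hα hβ hj)))

/-- Exponents add: 1 from n, 2β+1 from the normalized square, 2i and 2j from the derivative ratios.
-/
theorem oneAddDivAsymptotic_kernelTerm (hP : ∀ n, IsJacobi α β n (P n)) (i j : ℕ) :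
    OneAddDivAsymptotic (fun n : ℕ => (((n + 1 : ℕ) : ℝ) * kernelTerm hα hβ P i j (n + 1)) /
      (n * kernelTerm hα hβ P i j n)) (2 * (β + 1 + i + j)) := by
  have h := (OneAddDivAsymptotic.add_const_div 1 0).mul
    ((oneAddDivAsymptotic_normalizedSq hα hβ hP).mul
      ((oneAddDivAsymptotic_jacobiDerivRatio (α := α) hβ i).mul
        (oneAddDivAsymptotic_jacobiDerivRatio (α := α) hβ j)))
  rw [show (1 : ℝ) - 0 + (2 * β + 1 + (2 * i + 2 * j)) = 2 * (β + 1 + i + j) by ring] at h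
  refine h.congr' (Eventually.of_forall fun n => ?_)
  simp only [kernelTerm, mul_div_mul_comm, add_zero, Nat.cast_add, Nat.cast_one]

theorem tendsto_kernelTerm_atTop (hP : ∀ n, IsJacobi α β n (P n)) (i j : ℕ) :
    Tendsto (fun n : ℕ => n * kernelTerm hα hβ P i j n) atTop atTop :=
  tendsto_atTop_of_oneAddDivAsymptotic (s := 2 * (β + 1 + i + j))
    (by have : (0 : ℝ) ≤ i := i.cast_nonneg
        have : (0 : ℝ) ≤ j := j.cast_nonneg
        linarith)
    (eventually_kernelTerm_pos hα hβ hP i j) (oneAddDivAsymptotic_kernelTerm hα hβ hP i j)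
    (kernelTerm_nonneg hα hβ hP i j) (Eventually.of_forall fun _ => rfl)

theorem tendsto_sum_kernelTerm_div (hP : ∀ n, IsJacobi α β n (P n)) (i j : ℕ) :
    Tendsto (fun n : ℕ => (∑ m ∈ Finset.range n, kernelTerm hα hβ P i j m) /
      (n * kernelTerm hα hβ P i j n)) atTop (𝓝 (2 * (β + 1 + i + j))⁻¹) :=
  tendsto_sum_div_of_oneAddDivAsymptotic
    (by have : (0 : ℝ) ≤ i := i.cast_nonneg
        have : (0 : ℝ) ≤ j := j.cast_nonneg
        linarith)
    (eventually_kernelTerm_pos hα hβ hP i j) (oneAddDivAsymptotic_kernelTerm hα hβ hP i j)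
    (kernelTerm_nonneg hα hβ hP i j) (Eventually.of_forall fun _ => rfl)

/-- The value at `-1` of the `j`-th derivative, as a linear functional. -/
noncomputable def derivEval (j : ℕ) : ℝ[X] →ₗ[ℝ] ℝ := leval (-1) ∘ₗ (derivative ^ j)

theorem derivEval_apply (j : ℕ) (p : ℝ[X]) : derivEval j p = (derivative^[j] p).eval (-1) := by
  simp [derivEval, leval, Module.End.pow_apply]

theorem kernelSum_derivEval (hP : ∀ n, IsJacobi α β n (P n)) (i j n : ℕ) :
    kernelSum (jacobiBilin hα hβ) P (derivEval i) (derivEval j) n =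
      (-1) ^ i * (-1) ^ j * ∑ m ∈ Finset.range n, kernelTerm hα hβ P i j m := by
  rw [kernelSum, Finset.mul_sum]
  refine Finset.sum_congr rfl fun m _ => ?_
  rw [derivEval_apply, derivEval_apply, (hP m).eval_iterate_derivative,
    (hP m).eval_iterate_derivative, kernelTerm, normalizedSq]
  ring

theorem perturbedForm_derivEval (M N : ℝ) :
    perturbedForm (jacobiBilin hα hβ) (derivEval 0) (derivEval 1) M N =
      sobolevForm α β (-1) M N := by
  funext p q
  simp [perturbedForm, sobolevForm, derivEval_apply, jacobiBilin_apply]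

end JacobiAsymptotics

/-! ### The limit of the ratio -/

section Limit

variable {α β : ℝ} (hα : -1 < α) (hβ : -1 < β) {P : ℕ → ℝ[X]} {M N : ℝ}

/-- The kernel sums normalized by `n` times their general term. -/
noncomputable def normalizedKernel (P : ℕ → ℝ[X]) (i j n : ℕ) : ℝ :=
  (∑ m ∈ Finset.range n, kernelTerm hα hβ P i j m) / (n * kernelTerm hα hβ P i j n)

/-- Separates the growth, a product of a factor in i and a factor in j, from a convergent factor;
the growth then cancels in every quotient. -/
theorem kernelSum_eq_normalizedKernel (hP : ∀ n, IsJacobi α β n (P n)) (i j : ℕ) :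
    ∀ᶠ n : ℕ in atTop, kernelSum (jacobiBilin hα hβ) P (derivEval i) (derivEval j) n =
      (n * normalizedSq (jacobiBilin hα hβ) P n) * ((-1) ^ i * jacobiDerivRatio α β i n) *
        ((-1) ^ j * jacobiDerivRatio α β j n) * normalizedKernel hα hβ P i j n := by
  filter_upwards [eventually_kernelTerm_pos hα hβ hP i j] with n hn
  rw [kernelSum_derivEval hα hβ hP, ← mul_div_cancel_left₀ (∑ m ∈ Finset.range n, _) hn.ne',
    mul_div_assoc, ← normalizedKernel, kernelTerm]
  ring

/-- The determinant of the perturbation, divided by its expected order of magnitude. -/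
noncomputable def normalizedDet (P : ℕ → ℝ[X]) (M N : ℝ) (n : ℕ) : ℝ :=
  ((M * (n * kernelTerm hα hβ P 0 0 n))⁻¹ + normalizedKernel hα hβ P 0 0 n) *
    ((N * (n * kernelTerm hα hβ P 1 1 n))⁻¹ + normalizedKernel hα hβ P 1 1 n) -
    normalizedKernel hα hβ P 0 1 n ^ 2

theorem perturbationDet_eq (hM : M ≠ 0) (hN : N ≠ 0) (hP : ∀ n, IsJacobi α β n (P n)) :
    ∀ᶠ n : ℕ in atTop, perturbationDet (jacobiBilin hα hβ) P (derivEval 0) (derivEval 1) M N n =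
      M * N * (n * normalizedSq (jacobiBilin hα hβ) P n) ^ 2 * jacobiDerivRatio α β 1 n ^ 2 *
        normalizedDet hα hβ P M N n := by
  filter_upwards [kernelSum_eq_normalizedKernel hα hβ hP 0 0,
    kernelSum_eq_normalizedKernel hα hβ hP 0 1, kernelSum_eq_normalizedKernel hα hβ hP 1 1,
    eventually_gt_atTop 0] with n h00 h01 h11 hn
  have h0 : jacobiDerivRatio α β 0 n = 1 := by simp [jacobiDerivRatio]
  have h1 := (jacobiDerivRatio_pos hα hβ hn).ne'
  have hG := (normalizedSq_pos hα hβ hP n).ne'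
  have hn' : (n : ℝ) ≠ 0 := by exact_mod_cast hn.ne'
  rw [perturbationDet, h00, h01, h11, normalizedDet, kernelTerm, kernelTerm, h0]
  field_simp

theorem tendsto_inv_mul_kernelTerm (c : ℝ) (hP : ∀ n, IsJacobi α β n (P n)) (i : ℕ) :
    Tendsto (fun n : ℕ => (c * (n * kernelTerm hα hβ P i i n))⁻¹) atTop (𝓝 0) := by
  have h := (tendsto_kernelTerm_atTop hα hβ hP i i).inv_tendsto_atTop.const_mul c⁻¹
  rw [mul_zero] at h
  exact h.congr fun n => by rw [mul_inv]; rfl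

theorem limit_det_eq (hβ : -1 < β) :
    (2 * (β + 1))⁻¹ * (2 * (β + 3))⁻¹ - (2 * (β + 2))⁻¹ ^ 2 =
      (4 * (β + 1) * (β + 3) * (β + 2) ^ 2)⁻¹ := by
  have h1 : 0 < β + 1 := by linarith
  have h2 : 0 < β + 2 := by linarith
  have h3 : 0 < β + 3 := by linarith
  field_simp
  ring

/-- The leading growth of the 2×2 determinant does not cancel, so the system is eventually solvable
for all nonzero M, N. -/
theorem limit_det_pos (hβ : -1 < β) :
    0 < (2 * (β + 1))⁻¹ * (2 * (β + 3))⁻¹ - (2 * (β + 2))⁻¹ ^ 2 := by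
  have h1 : 0 < β + 1 := by linarith
  have h2 : 0 < β + 2 := by linarith
  have h3 : 0 < β + 3 := by linarith
  rw [limit_det_eq hβ]
  positivity

/-- The left side tends to 1 as j → ∞ and has simple poles at -(β+1), -(β+2). At j = 0 and j = 1 the
bracket equals the determinant, so these are the zeros. -/
theorem limit_value (hβ : -1 < β) (j : ℕ) :
    1 - (((2 * (β + 3))⁻¹ - (2 * (β + 2))⁻¹) * (2 * (β + 1 + j))⁻¹ +
      ((2 * (β + 1))⁻¹ - (2 * (β + 2))⁻¹) * (2 * (β + 2 + j))⁻¹) /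
      ((2 * (β + 1))⁻¹ * (2 * (β + 3))⁻¹ - (2 * (β + 2))⁻¹ ^ 2) =
    (j : ℝ) * (j - 1) / ((β + j + 1) * (β + j + 2)) := by
  have h0 : (0 : ℝ) ≤ j := j.cast_nonneg
  have h1 : 0 < β + 1 := by linarith
  have h2 : 0 < β + 2 := by linarith
  have h3 : 0 < β + 3 := by linarith
  have h4 : 0 < β + 1 + j := by linarith
  have h5 : 0 < β + 2 + j := by linarith
  have h6 : 0 < β + j + 1 := by linarith
  have h7 : 0 < β + j + 2 := by linarith
  rw [limit_det_eq hβ]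
  field_simp
  ring

theorem tendsto_normalizedKernel (hP : ∀ n, IsJacobi α β n (P n)) (i j : ℕ) :
    Tendsto (normalizedKernel hα hβ P i j) atTop (𝓝 (2 * (β + 1 + i + j))⁻¹) :=
  tendsto_sum_kernelTerm_div hα hβ hP i j

theorem tendsto_normalizedDet (M N : ℝ) (hP : ∀ n, IsJacobi α β n (P n)) :
    Tendsto (normalizedDet hα hβ P M N) atTop
      (𝓝 ((2 * (β + 1))⁻¹ * (2 * (β + 3))⁻¹ - (2 * (β + 2))⁻¹ ^ 2)) := by
  have h := (((tendsto_inv_mul_kernelTerm hα hβ M hP 0).add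
    (tendsto_normalizedKernel hα hβ hP 0 0)).mul
    ((tendsto_inv_mul_kernelTerm hα hβ N hP 1).add
    (tendsto_normalizedKernel hα hβ hP 1 1))).sub ((tendsto_normalizedKernel hα hβ hP 0 1).pow 2)
  refine h.trans (le_of_eq ?_)
  rw [show β + 1 + ((1 : ℕ) : ℝ) + ((1 : ℕ) : ℝ) = β + 3 by push_cast; ring,
    show β + 1 + ((0 : ℕ) : ℝ) + ((1 : ℕ) : ℝ) = β + 2 by push_cast; ring]
  simp only [Nat.cast_zero, add_zero, zero_add]

theorem eventually_perturbationDet_ne_zero (hM : M ≠ 0) (hN : N ≠ 0)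
    (hP : ∀ n, IsJacobi α β n (P n)) :
    ∀ᶠ n : ℕ in atTop,
      perturbationDet (jacobiBilin hα hβ) P (derivEval 0) (derivEval 1) M N n ≠ 0 := by
  filter_upwards [perturbationDet_eq hα hβ hM hN hP, eventually_gt_atTop 0,
    (tendsto_normalizedDet hα hβ M N hP).eventually_ne (limit_det_pos hβ).ne'] with n h hn hd
  have h1 := (jacobiDerivRatio_pos hα hβ hn).ne'
  have hG := (normalizedSq_pos hα hβ hP n).ne'
  have hn' : (n : ℝ) ≠ 0 := by exact_mod_cast hn.ne'
  rw [h]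
  positivity

theorem eventually_derivEval_ratio_eq (hM : M ≠ 0) (hN : N ≠ 0)
    (hP : ∀ n, IsJacobi α β n (P n)) {Q : ℕ → ℝ[X]}
    (hQ : ∀ᶠ n in atTop, IsMonicOrthogonal (sobolevForm α β (-1) M N) n (Q n)) (j : ℕ) :
    ∀ᶠ n : ℕ in atTop, derivEval j (Q n) / derivEval j (P n) =
      1 - (((N * (n * kernelTerm hα hβ P 1 1 n))⁻¹ + normalizedKernel hα hβ P 1 1 n -
          normalizedKernel hα hβ P 0 1 n) * normalizedKernel hα hβ P 0 j n +
        ((M * (n * kernelTerm hα hβ P 0 0 n))⁻¹ + normalizedKernel hα hβ P 0 0 n -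
          normalizedKernel hα hβ P 0 1 n) * normalizedKernel hα hβ P 1 j n) /
        normalizedDet hα hβ P M N n := by
  have hP' : ∀ m, IsMonicOrthogonal (fun p q => jacobiBilin hα hβ p q) m (P m) :=
    fun m => (jacobiBilin_eq hα hβ).symm ▸ (hP m).orth
  filter_upwards [hQ, perturbationDet_eq hα hβ hM hN hP,
    eventually_perturbationDet_ne_zero hα hβ hM hN hP,
    (tendsto_normalizedDet hα hβ M N hP).eventually_ne (limit_det_pos hβ).ne',
    kernelSum_eq_normalizedKernel hα hβ hP 0 0,
    kernelSum_eq_normalizedKernel hα hβ hP 0 1, kernelSum_eq_normalizedKernel hα hβ hP 1 1,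
    kernelSum_eq_normalizedKernel hα hβ hP 0 j, kernelSum_eq_normalizedKernel hα hβ hP 1 j,
    eventually_gt_atTop 0, eventually_ge_atTop j]
    with n hq hDeq hD hd h00 h01 h11 h0j h1j hn hj
  rw [← perturbedForm_derivEval hα hβ] at hq
  have hval := perturbed_values (jacobiBilin_symm hα hβ) (jacobiBilin_pos hα hβ) hP' hD hq
  have heq := congrArg (derivEval j) (eq_of_isMonicOrthogonal_perturbedForm
    (jacobiBilin_symm hα hβ) (jacobiBilin_pos hα hβ) hP' hq)
  have hA : ∀ i, derivEval i (P n) =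
      ((-1) ^ i * jacobiDerivRatio α β i n) * (P n).eval (-1) := fun i => by
    rw [derivEval_apply, (hP n).eval_iterate_derivative]
  have h0 : jacobiDerivRatio α β 0 n = 1 := by simp [jacobiDerivRatio]
  have h1 := (jacobiDerivRatio_pos hα hβ hn).ne'
  have hj' : (-1) ^ j * jacobiDerivRatio α β j n ≠ 0 :=
    mul_ne_zero (by simp) (jacobiDerivRatio_pos hα hβ hj).ne'
  have hG := (normalizedSq_pos hα hβ hP n).ne'
  have hn' : (n : ℝ) ≠ 0 := by exact_mod_cast hn.ne'
  have hA0 := (hP n).eval_ne_zero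
  rw [map_sub, map_sub, map_smul, map_smul, map_reproducing, map_reproducing, hval.1, hval.2,
    smul_eq_mul, smul_eq_mul, hDeq, h00, h01, h11, h0j, h1j, hA, hA, hA, h0, pow_zero, pow_one,
    mul_one, one_mul] at heq
  rw [heq, hA, kernelTerm, kernelTerm, h0]
  -- What remains is a rational identity in independent quantities; the determinant enters only as a
  -- common denominator and is not expanded.
  generalize normalizedDet hα hβ P M N n = E at *
  generalize (-1) ^ j * jacobiDerivRatio α β j n = w at *
  generalize normalizedSq (jacobiBilin hα hβ) P n = G at *
  generalize jacobiDerivRatio α β 1 n = w1 at *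
  generalize (P n).eval (-1) = A at *
  field_simp
  ring

theorem tendsto_derivEval_ratio (hα : -1 < α) (hβ : -1 < β) (hM : M ≠ 0) (hN : N ≠ 0)
    (hP : ∀ n, IsJacobi α β n (P n)) {Q : ℕ → ℝ[X]}
    (hQ : ∀ᶠ n in atTop, IsMonicOrthogonal (sobolevForm α β (-1) M N) n (Q n)) (j : ℕ) :
    Tendsto (fun n => derivEval j (Q n) / derivEval j (P n)) atTop
      (𝓝 ((j : ℝ) * (j - 1) / ((β + j + 1) * (β + j + 2)))) := by
  have hk := tendsto_normalizedKernel hα hβ hP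
  have h := (((((tendsto_inv_mul_kernelTerm hα hβ N hP 1).add (hk 1 1)).sub (hk 0 1)).mul
    (hk 0 j)).add
    ((((tendsto_inv_mul_kernelTerm hα hβ M hP 0).add (hk 0 0)).sub (hk 0 1)).mul
    (hk 1 j))).div (tendsto_normalizedDet hα hβ M N hP) (limit_det_pos hβ).ne'
  have h2 := h.const_sub 1
  rw [← limit_value hβ j]
  refine (Tendsto.congr' ?_ h2).trans (le_of_eq ?_)
  · filter_upwards [eventually_derivEval_ratio_eq hα hβ hM hN hP hQ j] with n hn
    exact hn.symm
  · rw [show β + 1 + ((1 : ℕ) : ℝ) + ((1 : ℕ) : ℝ) = β + 3 by push_cast; ring,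
      show β + 1 + ((0 : ℕ) : ℝ) + ((1 : ℕ) : ℝ) = β + 2 by push_cast; ring,
      show β + 1 + ((1 : ℕ) : ℝ) + (j : ℝ) = β + 2 + j by push_cast; ring]
    simp only [Nat.cast_zero, add_zero, zero_add]

end Limit

theorem jacobiScale_ne_zero {α β : ℝ} (hα : -1 < α) (hβ : -1 < β) {n : ℕ} (hn : 0 < n) :
    jacobiScale α β n ≠ 0 := by
  have hn' : (1 : ℝ) ≤ n := by exact_mod_cast hn
  exact div_ne_zero (ascPochhammer_pos n _ (by linarith)).ne'
    (mul_ne_zero (by positivity) (ascPochhammer_pos n _ (by linarith)).ne')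

theorem isJacobi_monicOrthogonal {α β : ℝ} (hα : -1 < α) (hβ : -1 < β) (n : ℕ) :
    IsJacobi α β n (monicOrthogonal (jacobiForm α β) n) := by
  refine ⟨hα, hβ, monicOrthogonal_spec ?_⟩
  rw [← jacobiBilin_eq hα hβ]
  exact existsUnique_isMonicOrthogonal (jacobiBilin_symm hα hβ) (jacobiBilin_pos hα hβ) n

theorem proposition4p4 (α β M N : ℝ) (hα : -1 < α) (hβ : -1 < β) (hM : M ≠ 0) (hN : N ≠ 0) :
    (∀ᶠ n : ℕ in atTop, ∃! q : ℝ[X], IsMonicOrthogonal (sobolevForm α β (-1) M N) n q) ∧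
    ∀ j : ℕ,
      (∀ᶠ n : ℕ in atTop, (derivative^[j] (scaledJacobi α β n)).eval (-1) ≠ 0) ∧
      Tendsto
        (fun n : ℕ => (derivative^[j] (scaledSobolevJacobi α β M N n)).eval (-1) /
          (derivative^[j] (scaledJacobi α β n)).eval (-1))
        atTop
        (𝓝 ((j : ℝ) * ((j : ℝ) - 1) / ((β + (j : ℝ) + 1) * (β + (j : ℝ) + 2)))) := by
  have hP := isJacobi_monicOrthogonal hα hβ
  have hP' : ∀ m, IsMonicOrthogonal (fun p q => jacobiBilin hα hβ p q) m
      (monicOrthogonal (jacobiForm α β) m) :=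
    fun m => (jacobiBilin_eq hα hβ).symm ▸ (hP m).orth
  have hQ : ∀ᶠ n : ℕ in atTop,
      ∃! q : ℝ[X], IsMonicOrthogonal (sobolevForm α β (-1) M N) n q := by
    filter_upwards [eventually_perturbationDet_ne_zero hα hβ hM hN hP] with n hn
    rw [← perturbedForm_derivEval hα hβ]
    exact existsUnique_perturbed (jacobiBilin_symm hα hβ) (jacobiBilin_pos hα hβ) hP' hn
  refine ⟨hQ, fun j => ⟨?_, ?_⟩⟩
  · filter_upwards [eventually_gt_atTop 0, eventually_ge_atTop j] with n hn hj
    rw [scaledJacobi, iterate_derivative_C_mul, eval_mul, eval_C,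
      (hP n).eval_iterate_derivative]
    exact mul_ne_zero (jacobiScale_ne_zero hα hβ hn) (mul_ne_zero (mul_ne_zero (by simp)
      (jacobiDerivRatio_pos hα hβ hj).ne') (hP n).eval_ne_zero)
  -- By `hQ` the default value 0 of `monicOrthogonal` occurs for only finitely many n; the common
  -- scale cancels in the quotient.
  · refine (tendsto_derivEval_ratio hα hβ hM hN hP
      (hQ.mono fun n hn => monicOrthogonal_spec hn) j).congr' ?_
    filter_upwards [eventually_gt_atTop 0] with n hn
    rw [scaledJacobi, scaledSobolevJacobi, iterate_derivative_C_mul, iterate_derivative_C_mul,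
      eval_mul, eval_mul, eval_C, mul_div_mul_left _ _ (jacobiScale_ne_zero hα hβ hn),
      derivEval_apply, derivEval_apply]
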